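/- Let $K$ be a countably infinite field and let $(F_N)_{N\in\mathbb N}$ be a double Følner sequence in $K$, that is, a sequence of non-empty finite subsets of $K$ such that for every $x\in K\setminus\{0\}$ $$\lim_{N\to\infty}\frac{|F_N\cap(F_N+x)|}{|F_N|}=\lim_{N\to\infty}\frac{|F_N\cap(xF_N)|}{|F_N|}=1 .$$ For $E\subset K$ let $\bar d_{(F_N)}(E):=\limsup_{N\to\infty}\frac{|F_N\cap E|}{|F_N|}$ denote the upper density of $E$ with respect to $(F_N)$. Then for any finite coloring $K=\bigcup_i C_i$ (i.e. any finite family of subsets covering $K$) there exist a color $C_i$ and a subset $D\subset C_i$ with $\bar d_{(F_N)}(D)>0$ such that for each $u\in D$ there is a set $D_u\subset K$ with $\bar d_{(F_N)}(D_u)>0$ such that $\{u,\,y+u,\,yu\}\subset C_i$ for every $y\in D_u$. -/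

import Mathlib

open Filter Topology

/-- A sequence of non-empty finite subsets of a field `K` is a double Følner sequence if for every
nonzero `x` both `|F_N ∩ (F_N + x)| / |F_N|` and `|F_N ∩ x F_N| / |F_N|` tend to `1`. -/
structure IsDoubleFolner {K : Type*} [Field K] (F : ℕ → Finset K) : Prop where
  nonempty : ∀ N, (F N).Nonempty
  tendsto_add : ∀ x : K, x ≠ 0 →
    Tendsto (fun N => (((F N : Set K) ∩ ((fun a => a + x) '' (F N : Set K))).ncard : ℝ) /
      ((F N).card : ℝ)) atTop (𝓝 1)
  tendsto_mul : ∀ x : K, x ≠ 0 →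
    Tendsto (fun N => (((F N : Set K) ∩ ((fun a => x * a) '' (F N : Set K))).ncard : ℝ) /
      ((F N).card : ℝ)) atTop (𝓝 1)

/-- The upper density of `E` with respect to the sequence `F` of finite sets:
the limsup of `|F_N ∩ E| / |F_N|` (a sequence of numbers in `[0, 1]`). -/
noncomputable def upperDensity {K : Type*} (F : ℕ → Finset K) (E : Set K) : ℝ :=
  limsup (fun N => (((F N : Set K) ∩ E).ncard : ℝ) / ((F N).card : ℝ)) atTop

/-!
The upper density is bounded below by the mean `l` obtained as the limit, along a non-principal
ultrafilter, of the averages over the sets `F N`. This mean is invariant under all affine maps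
`x ↦ a * x + s` with `a ≠ 0`, so it suffices to find sets of positive mean.

The main tool is an ergodic theorem (`sq_le_average_correlation`): if `L` is an affine invariant mean
on a `K`-vector space `X` with a distinguished vector `e`, and `|f| ≤ 1`, then the average over `u`,
with respect to `l`, of `L (f (x + u • e) * f (u • x))` is at least `L f ^ 2`. After the change of
variables `x ↦ u⁻¹ • x` this concerns the average of the functions `f (u⁻¹ • x + u • e)`. Van der
Corput's trick along the multiplicative group (`vanDerCorput`) shows that this weak average vanishes
if `f` is a coboundary for a translation (`average_coboundary`): the products of two multiplicative
shifts involve a translation by `u` times a constant, and averaging over `u` makes these telescope. So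
`f` may be replaced by a convex combination of its translates, and this in turn by a convex
combination of dilates. Choosing these combinations with nearly minimal `L²`-norm makes them nearly
invariant under all translations and dilations, uniformly
(`exists_mem_orbitHull_almost_invariant`), and then the average is close to the squared norm of an
element of the hull, which is at least `L f ^ 2` by Cauchy–Schwarz. Working with near minimizers
replaces the orthogonal projections of the mean ergodic theorem, so that the semi-inner product
`L (f * g)` on bounded functions suffices and no completion is needed.

For a coloring, let `J` be the set of colors of positive mean and apply the theorem to the power
`J → K`, with the mean along the powers of the `F N`, and the indicator function of the product of
the sets `C j`. The correlation factors over the coordinates, so a set of `u` of positive mean starts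
patterns `{y + u, y * u} ⊆ C j`, with `y` from a set of positive mean, for all `j ∈ J` simultaneously.
This set of `u` meets some color in a set of positive mean, and this color belongs to `J`.
-/

/-! ### Bounded functions and means -/

/-- A real-valued function is bounded (in absolute value, by a constant). -/
def IsBddFun {X : Type*} (f : X → ℝ) : Prop := ∃ c : ℝ, ∀ x, |f x| ≤ c

namespace IsBddFun

variable {X Y : Type*} {f g : X → ℝ}

lemma const (c : ℝ) : IsBddFun (fun _ : X => c) := ⟨|c|, fun _ => le_rfl⟩

lemma add (hf : IsBddFun f) (hg : IsBddFun g) : IsBddFun (f + g) := by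
  obtain ⟨c, hc⟩ := hf
  obtain ⟨d, hd⟩ := hg
  exact ⟨c + d, fun x => (abs_add_le _ _).trans (add_le_add (hc x) (hd x))⟩

lemma smul (a : ℝ) (hf : IsBddFun f) : IsBddFun (a • f) := by
  obtain ⟨c, hc⟩ := hf
  refine ⟨|a| * c, fun x => ?_⟩
  rw [Pi.smul_apply, smul_eq_mul, abs_mul]
  exact mul_le_mul_of_nonneg_left (hc x) (abs_nonneg a)

lemma sub (hf : IsBddFun f) (hg : IsBddFun g) : IsBddFun (f - g) := by
  have := hf.add (hg.smul (-1))
  rwa [neg_one_smul, ← sub_eq_add_neg] at this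

lemma mul (hf : IsBddFun f) (hg : IsBddFun g) : IsBddFun (f * g) := by
  obtain ⟨c, hc⟩ := hf
  obtain ⟨d, hd⟩ := hg
  refine ⟨c * d, fun x => ?_⟩
  rw [Pi.mul_apply, abs_mul]
  exact mul_le_mul (hc x) (hd x) (abs_nonneg _) ((abs_nonneg _).trans (hc x))

lemma comp (hf : IsBddFun f) (T : Y → X) : IsBddFun (f ∘ T) := by
  obtain ⟨c, hc⟩ := hf
  exact ⟨c, fun y => hc (T y)⟩

lemma sum {κ : Type*} (s : Finset κ) {φ : κ → X → ℝ} (h : ∀ i ∈ s, IsBddFun (φ i)) :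
    IsBddFun (∑ i ∈ s, φ i) :=
  Finset.sum_induction _ _ (fun _ _ => add) (const 0) h

lemma indicator (s : Set X) : IsBddFun (s.indicator (1 : X → ℝ)) := by
  refine ⟨1, fun x => ?_⟩
  by_cases hx : x ∈ s <;> simp [hx]

end IsBddFun

lemma convex_setOf_isBddFun (X : Type*) : Convex ℝ {f : X → ℝ | IsBddFun f} :=
  fun _ hf _ hg a b _ _ _ => (hf.smul a).add (hg.smul b)

/-- A mean on `X`: a normalized functional which is non-negative on non-negative bounded functions.
It is taken to be linear on the space of all functions, which spares boundedness hypotheses in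
linear computations; its values on unbounded functions carry no information. -/
structure IsMean {X : Type*} (L : (X → ℝ) →ₗ[ℝ] ℝ) : Prop where
  nonneg : ∀ f, IsBddFun f → (∀ x, 0 ≤ f x) → 0 ≤ L f
  one : L 1 = 1

/-- The functional `L` does not change when a bounded function is composed with `T`. -/
def IsInvariantUnder {X : Type*} (L : (X → ℝ) →ₗ[ℝ] ℝ) (T : X → X) : Prop :=
  ∀ f, IsBddFun f → L (f ∘ T) = L f

namespace IsMean

variable {X : Type*} {L : (X → ℝ) →ₗ[ℝ] ℝ} {f g : X → ℝ}

lemma mono (hL : IsMean L) (hf : IsBddFun f) (hg : IsBddFun g) (h : ∀ x, f x ≤ g x) :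
    L f ≤ L g := by
  have := hL.nonneg (g - f) (hg.sub hf) (fun x => sub_nonneg.2 (h x))
  rwa [map_sub, sub_nonneg] at this

lemma const (hL : IsMean L) (c : ℝ) : L (fun _ => c) = c := by
  have : (fun _ : X => c) = c • (1 : X → ℝ) := by ext; simp
  rw [this, map_smul, hL.one, smul_eq_mul, mul_one]

lemma abs_le (hL : IsMean L) {c : ℝ} (h : ∀ x, |f x| ≤ c) : |L f| ≤ c := by
  have hf : IsBddFun f := ⟨c, h⟩
  have h1 := hL.mono hf (.const c) (fun x => (_root_.abs_le.1 (h x)).2)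
  have h2 := hL.mono (.const (-c)) hf (fun x => (_root_.abs_le.1 (h x)).1)
  rw [hL.const] at h1 h2
  exact _root_.abs_le.2 ⟨h2, h1⟩

lemma isBddFun_apply {κ : Type*} (hL : IsMean L) {φ : κ → X → ℝ} {c : ℝ}
    (h : ∀ u x, |φ u x| ≤ c) : IsBddFun fun u => L (φ u) :=
  ⟨c, fun u => hL.abs_le (h u)⟩

/-- The Cauchy–Schwarz inequality for the semi-inner product `L (f * g)`. -/
lemma sq_mul_le (hL : IsMean L) (hf : IsBddFun f) (hg : IsBddFun g) :
    L (f * g) ^ 2 ≤ L (f * f) * L (g * g) := by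
  have key : ∀ t : ℝ, 0 ≤ L (f * f) * (t * t) + (2 * L (f * g)) * t + L (g * g) := by
    intro t
    have h := hL.nonneg ((t • f + g) * (t • f + g))
      (((hf.smul t).add hg).mul ((hf.smul t).add hg)) (fun x => mul_self_nonneg _)
    have e : (t • f + g) * (t • f + g) = (t * t) • (f * f) + (2 * t) • (f * g) + g * g := by
      ext x; simp; ring
    rw [e] at h
    simp only [map_add, map_smul, smul_eq_mul] at h
    linarith
  have := discrim_le_zero key
  unfold discrim at this
  linarith

lemma sq_le (hL : IsMean L) (hf : IsBddFun f) : L f ^ 2 ≤ L (f * f) := by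
  have := hL.sq_mul_le hf (IsBddFun.const 1)
  have e1 : (f * fun _ => (1 : ℝ)) = f := by ext; simp
  have e2 : ((fun _ => (1 : ℝ)) * fun _ : X => (1 : ℝ)) = fun _ => 1 := by ext; simp
  rwa [e1, e2, hL.const, mul_one] at this

lemma abs_mul_le (hL : IsMean L) (hf : IsBddFun f) (hg : IsBddFun g) {a b : ℝ} (ha : 0 ≤ a)
    (hb : 0 ≤ b) (hfa : L (f * f) ≤ a ^ 2) (hgb : L (g * g) ≤ b ^ 2) : |L (f * g)| ≤ a * b := by
  refine abs_le_of_sq_le_sq ?_ (by positivity)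
  calc L (f * g) ^ 2 ≤ L (f * f) * L (g * g) := hL.sq_mul_le hf hg
    _ ≤ a ^ 2 * b ^ 2 := mul_le_mul hfa hgb
        (hL.nonneg _ (hg.mul hg) fun x => mul_self_nonneg _) (sq_nonneg a)
    _ = (a * b) ^ 2 := by ring

/-- A nearly shortest vector of a convex set which is stable under measure-preserving maps is
nearly invariant under all of these maps at once, by the parallelogram law. -/
lemma exists_almost_invariant (hL : IsMean L) {κ : Type*} (T : κ → X → X)
    (hT : ∀ k, IsInvariantUnder L (T k)) {Q : Set (X → ℝ)} (hQ : Convex ℝ Q) (hne : Q.Nonempty)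
    (hbdd : ∀ q ∈ Q, IsBddFun q) (hstab : ∀ q ∈ Q, ∀ k, q ∘ T k ∈ Q) {ε : ℝ} (hε : 0 < ε) :
    ∃ g ∈ Q, ∀ k, L ((g ∘ T k - g) * (g ∘ T k - g)) ≤ ε := by
  set V : Set ℝ := (fun q => L (q * q)) '' Q with hV
  have hVne : V.Nonempty := hne.image _
  have hVbdd : BddBelow V := by
    refine ⟨0, ?_⟩
    rintro _ ⟨q, hq, rfl⟩
    exact hL.nonneg _ ((hbdd q hq).mul (hbdd q hq)) fun x => mul_self_nonneg _
  obtain ⟨_, ⟨g, hg, rfl⟩, hlt⟩ := exists_lt_of_csInf_lt hVne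
    (lt_add_of_pos_right (sInf V) (by positivity : 0 < ε / 4))
  refine ⟨g, hg, fun k => ?_⟩
  have hmid : (1 / 2 : ℝ) • (g ∘ T k) + (1 / 2 : ℝ) • g ∈ Q :=
    hQ (hstab g hg k) hg (by norm_num) (by norm_num) (by norm_num)
  have hinf := csInf_le hVbdd ⟨_, hmid, rfl⟩
  have hpres : L ((g ∘ T k) * (g ∘ T k)) = L (g * g) := hT k (g * g) ((hbdd g hg).mul (hbdd g hg))
  have e1 : ((1 / 2 : ℝ) • (g ∘ T k) + (1 / 2 : ℝ) • g) * ((1 / 2 : ℝ) • (g ∘ T k) + (1 / 2 : ℝ) • g)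
      = (1 / 2 : ℝ) • ((g ∘ T k) * (g ∘ T k)) + (1 / 2 : ℝ) • (g * g)
        - (1 / 4 : ℝ) • ((g ∘ T k - g) * (g ∘ T k - g)) := by
    ext x; simp; ring
  simp only [e1, map_add, map_sub, map_smul, smul_eq_mul, hpres] at hinf
  linarith

end IsMean

/-! ### Means along sequences of finite sets -/

/-- `L f` is the limit along `p` of the averages of `f` over the finite sets `G N`, for every
bounded `f`. -/
def IsLimitOfAverages {X : Type*} (p : Ultrafilter ℕ) (G : ℕ → Finset X)
    (L : (X → ℝ) →ₗ[ℝ] ℝ) : Prop :=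
  ∀ f, IsBddFun f → Tendsto (fun N => (∑ x ∈ G N, f x) / ((G N).card : ℝ)) p (𝓝 (L f))

section LimitOfAverages

variable {X : Type*} {p : Ultrafilter ℕ} {G : ℕ → Finset X} {L : (X → ℝ) →ₗ[ℝ] ℝ}

lemma abs_average_le (s : Finset X) {f : X → ℝ} {c : ℝ} (h : ∀ x, |f x| ≤ c) (hc : 0 ≤ c) :
    |(∑ x ∈ s, f x) / (s.card : ℝ)| ≤ c := by
  rw [abs_div, Nat.abs_cast]
  refine div_le_of_le_mul₀ (by positivity) hc ?_
  calc |∑ x ∈ s, f x| ≤ ∑ x ∈ s, |f x| := Finset.abs_sum_le_sum_abs _ _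
    _ ≤ ∑ _x ∈ s, c := Finset.sum_le_sum fun x _ => h x
    _ = c * s.card := by rw [Finset.sum_const, nsmul_eq_mul, mul_comm]

/-- Limits along an ultrafilter exist by compactness and are linear on bounded functions; the values on
unbounded functions come from an arbitrary linear extension. -/
lemma exists_isLimitOfAverages (p : Ultrafilter ℕ) (G : ℕ → Finset X) :
    ∃ L : (X → ℝ) →ₗ[ℝ] ℝ, IsLimitOfAverages p G L := by
  have hlim : ∀ f : X → ℝ, IsBddFun f →
      ∃ l, Tendsto (fun N => (∑ x ∈ G N, f x) / ((G N).card : ℝ)) p (𝓝 l) := by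
    rintro f ⟨c, hc⟩
    have hc' : ∀ x, |f x| ≤ |c| := fun x => (hc x).trans (le_abs_self c)
    have hmem : (p.map (fun N => (∑ x ∈ G N, f x) / ((G N).card : ℝ)) : Ultrafilter ℝ) ≤
        𝓟 (Set.Icc (-|c|) |c|) := by
      rw [le_principal_iff, Ultrafilter.coe_map]
      exact Filter.mem_map.2 (Eventually.of_forall fun N =>
        abs_le.1 (abs_average_le (G N) hc' (abs_nonneg c)))
    obtain ⟨l, -, hl⟩ := isCompact_Icc.ultrafilter_le_nhds _ hmem
    exact ⟨l, hl⟩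
  let W : Submodule ℝ (X → ℝ) :=
    { carrier := {f | IsBddFun f}
      add_mem' := fun hf hg => hf.add hg
      zero_mem' := .const 0
      smul_mem' := fun a _ hf => hf.smul a }
  choose lim hlim using hlim
  let L₀ : W →ₗ[ℝ] ℝ :=
    { toFun := fun f => lim f.1 f.2
      map_add' := fun f g => by
        refine tendsto_nhds_unique (hlim _ (f + g).2) ?_
        refine ((hlim _ f.2).add (hlim _ g.2)).congr fun N => ?_
        simp [Finset.sum_add_distrib, add_div]
      map_smul' := fun a f => by
        refine tendsto_nhds_unique (hlim _ (a • f).2) ?_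
        refine ((hlim _ f.2).const_mul a).congr fun N => ?_
        simp [← Finset.mul_sum, mul_div_assoc] }
  obtain ⟨L, hL⟩ := L₀.exists_extend
  refine ⟨L, fun f hf => ?_⟩
  have : L f = lim f hf := LinearMap.congr_fun hL (⟨f, hf⟩ : W)
  rw [this]
  exact hlim f hf

lemma IsLimitOfAverages.isMean (hL : IsLimitOfAverages p G L) (hG : ∀ N, (G N).Nonempty) :
    IsMean L where
  nonneg f hf h := ge_of_tendsto' (hL f hf) fun N =>
    div_nonneg (Finset.sum_nonneg fun x _ => h x) (Nat.cast_nonneg _)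
  one := by
    refine tendsto_nhds_unique (hL 1 (.const 1)) (tendsto_const_nhds.congr fun N => ?_)
    have : ((G N).card : ℝ) ≠ 0 := by exact_mod_cast (hG N).card_pos.ne'
    simp [this]

lemma abs_sum_comp_sub_sum_le [DecidableEq X] (s : Finset X) {T : X → X}
    (hT : Function.Injective T) {f : X → ℝ} {c : ℝ} (h : ∀ x, |f x| ≤ c) :
    |∑ x ∈ s, f (T x) - ∑ x ∈ s, f x| ≤ 2 * c * (s.card - (s ∩ s.image T).card) := by
  have bound : ∀ t : Finset X, |∑ x ∈ t, f x| ≤ c * t.card := fun t =>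
    calc |∑ x ∈ t, f x| ≤ ∑ x ∈ t, |f x| := Finset.abs_sum_le_sum_abs _ _
      _ ≤ ∑ _x ∈ t, c := Finset.sum_le_sum fun x _ => h x
      _ = c * t.card := by rw [Finset.sum_const, nsmul_eq_mul, mul_comm]
  have e1 : ∑ x ∈ s, f (T x) = ∑ x ∈ s.image T, f x := (Finset.sum_image hT.injOn).symm
  have hcard : (s.image T).card = s.card := Finset.card_image_of_injective s hT
  have e2 := Finset.sum_inter_add_sum_sdiff s (s.image T) f
  have e3 := Finset.sum_inter_add_sum_sdiff (s.image T) s f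
  have c2 := Finset.card_inter_add_card_sdiff s (s.image T)
  have c3 := Finset.card_inter_add_card_sdiff (s.image T) s
  rw [Finset.inter_comm] at e3 c3
  rw [hcard] at c3
  have c2' : ((s \ s.image T).card : ℝ) = s.card - (s ∩ s.image T).card := by
    rw [← c2]; push_cast; ring
  have c3' : ((s.image T \ s).card : ℝ) = s.card - (s ∩ s.image T).card := by
    rw [← c3]; push_cast; ring
  have b2 := bound (s \ s.image T)
  have b3 := bound (s.image T \ s)
  rw [c2'] at b2
  rw [c3'] at b3
  have e4 : ∑ x ∈ s, f (T x) - ∑ x ∈ s, f x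
      = ∑ x ∈ s.image T \ s, f x - ∑ x ∈ s \ s.image T, f x := by
    rw [e1, ← e2, ← e3]; ring
  rw [e4]
  calc _ ≤ |∑ x ∈ s.image T \ s, f x| + |∑ x ∈ s \ s.image T, f x| := abs_sub _ _
    _ ≤ _ := by linarith

lemma IsLimitOfAverages.isInvariantUnder [DecidableEq X] (hL : IsLimitOfAverages p G L)
    (hG : ∀ N, (G N).Nonempty) {T : X → X} (hT : Function.Injective T)
    (h : Tendsto (fun N => (((G N) ∩ (G N).image T).card : ℝ) / ((G N).card : ℝ)) p (𝓝 1)) :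
    IsInvariantUnder L T := by
  rintro f ⟨c, hc⟩
  have h1 := hL _ (IsBddFun.comp ⟨c, hc⟩ T)
  have h2 := hL f ⟨c, hc⟩
  have h3 : Tendsto (fun N => 2 * c * (1 - (((G N) ∩ (G N).image T).card : ℝ) / ((G N).card : ℝ)))
      p (𝓝 0) := by
    simpa using (h.const_sub 1).const_mul (2 * c)
  rw [← sub_eq_zero]
  refine tendsto_nhds_unique (h1.sub h2) (squeeze_zero_norm (fun N => ?_) h3)
  have hpos : (0 : ℝ) < (G N).card := by exact_mod_cast (hG N).card_pos
  rw [← sub_div, Real.norm_eq_abs, abs_div, Nat.abs_cast, div_le_iff₀ hpos]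
  refine (abs_sum_comp_sub_sum_le (G N) hT hc).trans (le_of_eq ?_)
  field_simp

/-- Averages over the powers `(F N)^J` of a product of functions of the coordinates factor. -/
lemma IsLimitOfAverages.map_prod {K J : Type*} [Fintype J] [DecidableEq J] {F : ℕ → Finset K}
    {l : (K → ℝ) →ₗ[ℝ] ℝ} {L : ((J → K) → ℝ) →ₗ[ℝ] ℝ} (hl : IsLimitOfAverages p F l)
    (hL : IsLimitOfAverages p (fun N => Fintype.piFinset fun _ : J => F N) L)
    {f : J → K → ℝ} (hf : ∀ j, IsBddFun (f j)) (hprod : IsBddFun fun x : J → K => ∏ j, f j (x j)) :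
    L (fun x => ∏ j, f j (x j)) = ∏ j, l (f j) := by
  refine tendsto_nhds_unique (hL _ hprod)
    ((tendsto_finsetProd Finset.univ fun j _ => hl (f j) (hf j)).congr fun N => ?_)
  rw [Finset.prod_div_distrib, Fintype.card_piFinset, Finset.prod_univ_sum]
  push_cast
  rfl

/-- Maps which act on every coordinate by `T` inherit asymptotic invariance from `T`. -/
lemma tendsto_card_piFinset_inter {K J : Type*} [DecidableEq K] [Fintype J] [DecidableEq J]
    {F : ℕ → Finset K} {T : K → K} {l : Filter ℕ}
    (h : Tendsto (fun N => (((F N) ∩ (F N).image T).card : ℝ) / ((F N).card : ℝ)) l (𝓝 1)) :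
    Tendsto (fun N => (((Fintype.piFinset fun _ : J => F N) ∩
      (Fintype.piFinset fun _ : J => F N).image fun x j => T (x j)).card : ℝ) /
        ((Fintype.piFinset fun _ : J => F N).card : ℝ)) l (𝓝 1) := by
  have := h.pow (Fintype.card J)
  rw [one_pow] at this
  refine this.congr fun N => ?_
  rw [← Fintype.piFinset_image (fun _ : J => T), ← Fintype.piFinset_inter,
    Fintype.card_piFinset, Fintype.card_piFinset, div_pow]
  simp

end LimitOfAverages

/-! ### Convex hulls of orbits -/

/-- The convex hull of the functions `f ∘ T k`. -/
def orbitHull {X κ : Type*} (T : κ → X → X) (f : X → ℝ) : Set (X → ℝ) :=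
  convexHull ℝ (Set.range fun k => f ∘ T k)

section OrbitHull

variable {X κ : Type*} {L : (X → ℝ) →ₗ[ℝ] ℝ} {T : κ → X → X} {f q : X → ℝ}

lemma orbitHull_subset {s : Set (X → ℝ)} (hs : Convex ℝ s) (h : ∀ k, f ∘ T k ∈ s) :
    orbitHull T f ⊆ s :=
  convexHull_min (Set.range_subset_iff.2 h) hs

lemma convex_setOf_abs_le (X : Type*) (c : ℝ) : Convex ℝ {f : X → ℝ | ∀ x, |f x| ≤ c} := by
  intro f hf g hg a b ha hb hab x
  calc |a * f x + b * g x| ≤ |a * f x| + |b * g x| := abs_add_le _ _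
    _ = a * |f x| + b * |g x| := by rw [abs_mul, abs_mul, abs_of_nonneg ha, abs_of_nonneg hb]
    _ ≤ a * c + b * c := add_le_add (mul_le_mul_of_nonneg_left (hf x) ha)
        (mul_le_mul_of_nonneg_left (hg x) hb)
    _ = c := by rw [← add_mul, hab, one_mul]

lemma abs_le_of_mem_orbitHull {c : ℝ} (hf : ∀ x, |f x| ≤ c) (hq : q ∈ orbitHull T f) (x : X) :
    |q x| ≤ c :=
  orbitHull_subset (convex_setOf_abs_le X c) (fun k x => hf (T k x)) hq x

lemma apply_eq_of_mem_orbitHull (Φ : (X → ℝ) →ₗ[ℝ] ℝ) {r : ℝ} (h : ∀ k, Φ (f ∘ T k) = r)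
    (hq : q ∈ orbitHull T f) : Φ q = r :=
  orbitHull_subset (convex_hyperplane Φ.isLinear r) h hq

lemma exists_mem_orbitHull_almost_invariant [Nonempty κ] (hL : IsMean L)
    (hT : ∀ k, IsInvariantUnder L (T k)) (hcomp : ∀ k l, ∃ m, T k ∘ T l = T m)
    (hf : IsBddFun f) {ε : ℝ} (hε : 0 < ε) :
    ∃ g ∈ orbitHull T f, ∀ k, L ((g ∘ T k - g) * (g ∘ T k - g)) ≤ ε := by
  refine hL.exists_almost_invariant T hT (convex_convexHull ℝ _)
    ((Set.range_nonempty _).convexHull) (fun q hq => ?_) (fun q hq l => ?_) hε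
  · exact orbitHull_subset (convex_setOf_isBddFun X) (fun k => hf.comp _) hq
  · have hconv : Convex ℝ {q : X → ℝ | q ∘ T l ∈ orbitHull T f} := by
      intro a ha b hb s t hs ht hst
      exact convex_convexHull ℝ _ ha hb hs ht hst
    refine orbitHull_subset hconv (fun k => ?_) hq
    obtain ⟨m, hm⟩ := hcomp k l
    exact subset_convexHull ℝ _ ⟨m, congrArg (f ∘ ·) hm.symm⟩

/-- Pairing with an almost invariant function hardly distinguishes `f` from the convex
combinations of its translates. -/
lemma abs_sub_le_of_mem_orbitHull (hL : IsMean L) (hT : ∀ k, IsInvariantUnder L (T k))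
    (hf : ∀ x, |f x| ≤ 1) {g : X → ℝ} (hg : IsBddFun g) {ε : ℝ} (hε : 0 < ε)
    (hinv : ∀ k, L ((g ∘ T k - g) * (g ∘ T k - g)) ≤ ε ^ 2) (hq : q ∈ orbitHull T f) :
    |L (f * g) - L (q * g)| ≤ ε := by
  have hconv : Convex ℝ {q : X → ℝ | |L (f * g) - L (q * g)| ≤ ε} := by
    intro a ha b hb s t hs ht hst
    have e : L (f * g) - L ((s • a + t • b) * g)
        = s * (L (f * g) - L (a * g)) + t * (L (f * g) - L (b * g)) := by
      rw [add_mul, smul_mul_assoc, smul_mul_assoc, map_add, map_smul, map_smul, smul_eq_mul,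
        smul_eq_mul]
      linear_combination (-L (f * g)) * hst
    rw [Set.mem_ofPred_eq, e]
    calc _ ≤ |s * (L (f * g) - L (a * g))| + |t * (L (f * g) - L (b * g))| := abs_add_le _ _
      _ = s * |L (f * g) - L (a * g)| + t * |L (f * g) - L (b * g)| := by
        rw [abs_mul, abs_mul, abs_of_nonneg hs, abs_of_nonneg ht]
      _ ≤ s * ε + t * ε := add_le_add (mul_le_mul_of_nonneg_left ha hs)
        (mul_le_mul_of_nonneg_left hb ht)
      _ = ε := by rw [← add_mul, hst, one_mul]
  refine orbitHull_subset hconv (fun k => ?_) hq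
  have hfb : IsBddFun f := ⟨1, hf⟩
  have e1 : L (f * g) = L ((f ∘ T k) * (g ∘ T k)) := (hT k _ (hfb.mul hg)).symm
  rw [Set.mem_ofPred_eq, e1, ← map_sub, ← mul_sub, ← one_mul ε]
  refine hL.abs_mul_le (hfb.comp _) ((hg.comp _).sub hg) zero_le_one hε.le ?_ (hinv k)
  refine (le_abs_self _).trans (hL.abs_le fun x => ?_)
  rw [one_pow, Pi.mul_apply, abs_mul]
  exact mul_le_one₀ (hf _) (abs_nonneg _) (hf _)

end OrbitHull

/-! ### The ergodic theorem for the affine group of a field -/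

/-- The mean `L` on a `K`-vector space is invariant under the affine maps `x ↦ a • x + s • e`,
with `a ≠ 0`. -/
def IsAffineInvariant (K : Type*) {X : Type*} [Field K] [AddCommGroup X] [Module K X] (e : X)
    (L : (X → ℝ) →ₗ[ℝ] ℝ) : Prop :=
  ∀ a : K, a ≠ 0 → ∀ s : K, IsInvariantUnder L fun x => a • x + s • e

namespace IsAffineInvariant

variable {K X : Type*} [Field K] [AddCommGroup X] [Module K X] {e : X} {L : (X → ℝ) →ₗ[ℝ] ℝ}

lemma translation (h : IsAffineInvariant K e L) (s : K) :
    IsInvariantUnder L fun x => x + s • e := by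
  simpa using h 1 one_ne_zero s

lemma dilation (h : IsAffineInvariant K e L) {a : K} (ha : a ≠ 0) :
    IsInvariantUnder L fun x => a • x := by
  simpa using h a ha 0

end IsAffineInvariant

section Ergodic

variable {K X : Type*} [Field K] [AddCommGroup X] [Module K X] {e : X}
  {l : (K → ℝ) →ₗ[ℝ] ℝ} {L : (X → ℝ) →ₗ[ℝ] ℝ}

variable [Infinite K]

/-- A translation invariant mean on an infinite field does not see a single point. -/
lemma IsMean.abs_le_of_forall_ne_zero (hl : IsMean l) (hinv : IsAffineInvariant K (1 : K) l)
    {f : K → ℝ} (hf : IsBddFun f) {c : ℝ} (hc : 0 ≤ c) (h : ∀ u, u ≠ 0 → |f u| ≤ c) :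
    |l f| ≤ c := by
  classical
  set δ : K → ℝ := Set.indicator {0} 1 with hδ
  have hδb : IsBddFun δ := .indicator _
  have hδ1 : ∀ n : ℕ, n * l δ ≤ 1 := by
    intro n
    obtain ⟨s, -, hs⟩ := (Set.infinite_univ (α := K)).exists_subset_card_eq n
    have h1 : l (∑ a ∈ s, δ ∘ fun u => u + (-a) • (1 : K)) = n * l δ := by
      rw [map_sum, Finset.sum_congr rfl fun a _ => hinv.translation (-a) δ hδb]
      simp [hs]
    have h2 : ∀ u, (∑ a ∈ s, δ ∘ fun u => u + (-a) • (1 : K)) u ≤ 1 := by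
      intro u
      have : (∑ a ∈ s, δ ∘ fun u => u + (-a) • (1 : K)) u =
          ∑ a ∈ s, if u = a then (1 : ℝ) else 0 := by
        rw [Finset.sum_apply]
        refine Finset.sum_congr rfl fun a _ => ?_
        simp [hδ, Pi.single_apply, ← sub_eq_add_neg, sub_eq_zero]
      rw [this, Finset.sum_ite_eq]
      split_ifs <;> norm_num
    rw [← h1]
    refine (hl.mono (IsBddFun.sum s fun a _ => hδb.comp _) (IsBddFun.const 1) h2).trans_eq
      (hl.const 1)
  have hδ0 : l δ ≤ 0 := by
    by_contra! hpos
    obtain ⟨n, hn⟩ := exists_nat_gt (1 / l δ)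
    rw [div_lt_iff₀ hpos] at hn
    exact absurd (hδ1 n) (not_le.2 hn)
  obtain ⟨d, hd⟩ := hf
  have hd0 : 0 ≤ d := (abs_nonneg _).trans (hd 0)
  have hle : ∀ u, |f u| ≤ ((fun _ : K => c) + d • δ) u := by
    intro u
    by_cases hu : u = 0
    · subst hu
      simpa [hδ] using (hd 0).trans (le_add_of_nonneg_left hc)
    · simpa [hδ, hu] using h u hu
  have hb : IsBddFun ((fun _ => c) + d • δ) := (IsBddFun.const c).add (hδb.smul d)
  have hval : l ((fun _ => c) + d • δ) ≤ c := by
    rw [map_add, map_smul, hl.const, smul_eq_mul]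
    nlinarith
  have h1 := hl.mono ⟨d, hd⟩ hb fun u => (le_abs_self _).trans (hle u)
  have h2 := hl.mono (IsBddFun.smul (-1) ⟨d, hd⟩) hb fun u => by
    rw [Pi.smul_apply, neg_one_smul]
    exact (neg_le_abs _).trans (hle u)
  rw [map_smul, smul_eq_mul] at h2
  exact _root_.abs_le.2 ⟨by linarith, by linarith⟩

lemma IsMean.congr_of_forall_ne_zero (hl : IsMean l) (hinv : IsAffineInvariant K (1 : K) l)
    {f g : K → ℝ} (hf : IsBddFun f) (hg : IsBddFun g) (h : ∀ u, u ≠ 0 → f u = g u) :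
    l f = l g := by
  have := hl.abs_le_of_forall_ne_zero hinv (hf.sub hg) le_rfl fun u hu => by simp [h u hu]
  rw [map_sub] at this
  exact sub_eq_zero.1 (abs_nonpos_iff.1 this)

/-- In an infinite field there are arbitrarily many non-zero elements with distinct squares. -/
lemma exists_finset_card_eq_forall_sq (K : Type*) [Field K] [Infinite K] (n : ℕ) :
    ∃ (s : Finset K) (b : K → K), s.card = n ∧ ∀ t ∈ s, b t ≠ 0 ∧ b t ^ 2 = t := by
  classical
  have hinf : (Set.range fun x : K => x ^ 2).Infinite := by
    intro hfin
    refine Set.infinite_univ (α := K) ?_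
    refine (hfin.preimage' (f := fun x : K => x ^ 2) fun y _ => ?_).subset fun x _ => ⟨x, rfl⟩
    refine (Polynomial.nthRoots 2 y).toFinset.finite_toSet.subset fun x hx => ?_
    simpa [Polynomial.mem_nthRoots] using hx
  obtain ⟨s, hs, hn⟩ := (hinf.sdiff (Set.finite_singleton 0)).exists_subset_card_eq n
  choose! b hb using fun t (ht : t ∈ Set.range fun x : K => x ^ 2) => ht
  refine ⟨s, b, hn, fun t ht => ?_⟩
  have hbt : b t ^ 2 = t := hb t (hs ht).1
  refine ⟨fun h0 => (hs ht).2 ?_, hbt⟩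
  rw [h0] at hbt
  simpa using hbt.symm

/-- The affine map `x ↦ u⁻¹ • x + u • e`, through which the translation by `u` and the dilation by
`u` enter the correlations `L (f (x + u • e) * f (u • x))`. -/
def affineShear (e : X) (u : K) (x : X) : X := u⁻¹ • x + u • e

/-- Van der Corput's trick along the multiplicative group: if the functions `h ∘ affineShear e u` are
orthogonal on average to their multiplicative shifts, then their weak average vanishes. -/
lemma vanDerCorput (hl : IsMean l) (hlinv : IsAffineInvariant K (1 : K) l) (hL : IsMean L)
    {h w : X → ℝ} (hh : IsBddFun h) (hw : IsBddFun w)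
    (hor : ∀ b c : K, b ≠ 0 → c ≠ 0 → b ^ 2 ≠ c ^ 2 →
      l (fun u => L ((h ∘ affineShear e (b * u)) * (h ∘ affineShear e (c * u)))) = 0) :
    l (fun u => L (w * h ∘ affineShear e u)) = 0 := by
  obtain ⟨c, hc⟩ := hh
  obtain ⟨d, hd⟩ := hw
  have hc0 : 0 ≤ c := (abs_nonneg _).trans (hc 0)
  have hww : 0 ≤ L (w * w) := hL.nonneg _ (IsBddFun.mul ⟨d, hd⟩ ⟨d, hd⟩) fun x => mul_self_nonneg _
  set S := l (fun u => L (w * h ∘ affineShear e u)) with hS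
  have hSb : IsBddFun (fun u : K => L (w * h ∘ affineShear e u)) :=
    hL.isBddFun_apply (c := d * c) fun u x => by
      rw [Pi.mul_apply, abs_mul]
      exact mul_le_mul (hd x) (hc _) (abs_nonneg _) ((abs_nonneg _).trans (hd x))
  have hbb : ∀ b b' : K,
      IsBddFun (fun u => L ((h ∘ affineShear e (b * u)) * (h ∘ affineShear e (b' * u)))) :=
    fun b b' => hL.isBddFun_apply (c := c * c) fun u x => by
      rw [Pi.mul_apply, abs_mul]
      exact mul_le_mul (hc _) (hc _) (abs_nonneg _) hc0
  have key : ∀ n : ℕ, (n * S) ^ 2 ≤ L (w * w) * (n * c ^ 2) := by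
    intro n
    obtain ⟨s, b, hn, hb⟩ := exists_finset_card_eq_forall_sq K n
    set φ : K → X → ℝ := fun u => ∑ t ∈ s, h ∘ affineShear e (b t * u) with hφ
    have hφb : ∀ u, IsBddFun (φ u) := fun u =>
      IsBddFun.sum s fun t _ => IsBddFun.comp ⟨c, hc⟩ _
    have e1 : (fun u => L (w * φ u)) =
        ∑ t ∈ s, (fun u => L (w * h ∘ affineShear e u)) ∘ fun u => b t • u := by
      ext u
      simp [hφ, Finset.mul_sum, map_sum]
    have hψb : IsBddFun fun u => L (w * φ u) := by
      rw [e1]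
      exact IsBddFun.sum s fun t _ => hSb.comp _
    have h1 : l (fun u => L (w * φ u)) = n * S := by
      rw [e1, map_sum, Finset.sum_congr rfl fun t ht => hlinv.dilation (hb t ht).1 _ hSb]
      simp [hn, hS]
    have e2 : (fun u => L (w * w) * L (φ u * φ u)) = L (w * w) • ∑ t ∈ s, ∑ t' ∈ s,
        fun u => L ((h ∘ affineShear e (b t * u)) * (h ∘ affineShear e (b t' * u))) := by
      ext u
      simp [hφ, Finset.sum_mul_sum, map_sum]
    have hb2 : IsBddFun fun u => L (w * w) * L (φ u * φ u) := by
      rw [e2]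
      exact (IsBddFun.sum s fun t _ => IsBddFun.sum s fun t' _ => hbb _ _).smul _
    have h2 : l (fun u => L (w * w) * L (φ u * φ u)) ≤ L (w * w) * (n * c ^ 2) := by
      rw [e2, map_smul, smul_eq_mul, map_sum]
      refine mul_le_mul_of_nonneg_left ?_ hww
      calc _ ≤ ∑ _t ∈ s, c ^ 2 := Finset.sum_le_sum fun t ht => ?_
        _ = n * c ^ 2 := by rw [Finset.sum_const, hn, nsmul_eq_mul]
      rw [map_sum, Finset.sum_eq_single_of_mem t ht fun t' ht' hne => ?_]
      · refine (le_abs_self _).trans (hl.abs_le fun u => hL.abs_le fun x => ?_)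
        rw [Pi.mul_apply, abs_mul, sq]
        exact mul_le_mul (hc _) (hc _) (abs_nonneg _) hc0
      · refine hor _ _ (hb t ht).1 (hb t' ht').1 ?_
        rw [(hb t ht).2, (hb t' ht').2]
        exact hne.symm
    calc (n * S) ^ 2 = l (fun u => L (w * φ u)) ^ 2 := by rw [h1]
      _ ≤ l ((fun u => L (w * φ u)) * fun u => L (w * φ u)) := hl.sq_le hψb
      _ ≤ l (fun u => L (w * w) * L (φ u * φ u)) := hl.mono (hψb.mul hψb) hb2 fun u => by
          rw [Pi.mul_apply, ← sq]
          exact hL.sq_mul_le ⟨d, hd⟩ (hφb u)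
      _ ≤ _ := h2
  by_contra hne
  have hpos : 0 < S ^ 2 := by positivity
  obtain ⟨n, hn⟩ := exists_nat_gt (L (w * w) * c ^ 2 / S ^ 2)
  have hn0 : (0 : ℝ) < n := lt_of_le_of_lt (by positivity) hn
  rw [div_lt_iff₀ hpos] at hn
  have := key n
  have h3 := mul_lt_mul_of_pos_left hn hn0
  nlinarith

/-- The weak average of `h ∘ affineShear e u` vanishes when `h` is a coboundary for a translation. -/
lemma average_coboundary (hl : IsMean l) (hlinv : IsAffineInvariant K (1 : K) l) (hL : IsMean L)
    (hLinv : IsAffineInvariant K e L) {f w : X → ℝ} (hf : IsBddFun f) (hw : IsBddFun w) (v : K) :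
    l (fun u => L (w * (f - f ∘ fun x => x + v • e) ∘ affineShear e u)) = 0 := by
  set h : X → ℝ := f - f ∘ fun x => x + v • e with hh
  have hhb : IsBddFun h := hf.sub (hf.comp _)
  refine vanDerCorput hl hlinv hL hhb hw fun b c hb hc hbc => ?_
  have hbdd : ∀ (k k' : X → ℝ) (_ : IsBddFun k) (_ : IsBddFun k') (T T' : K → X → X),
      IsBddFun fun u => L ((k ∘ T u) * (k' ∘ T' u)) := by
    rintro k k' ⟨c, hc⟩ ⟨d, hd⟩ T T'
    refine hL.isBddFun_apply (c := c * d) fun u x => ?_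
    rw [Pi.mul_apply, abs_mul]
    exact mul_le_mul (hc _) (hd _) (abs_nonneg _) ((abs_nonneg _).trans (hc x))
  set k : X → ℝ := h ∘ fun x => (b⁻¹ * c) • x with hk
  have hkb : IsBddFun k := hhb.comp _
  set d : K := c - b ^ 2 * c⁻¹ with hd
  have hd0 : d ≠ 0 := by
    intro h0
    apply hbc
    rw [hd, sub_eq_zero] at h0
    field_simp at h0
    exact h0.symm
  set Ψ : K → ℝ := fun u => L ((k ∘ id) * (f ∘ fun x => x + u • e)) with hΨ
  have hΨb : IsBddFun Ψ := hbdd k f hkb hf (fun _ => id) _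
  set Ψ' : K → ℝ := fun u => L ((k ∘ id) * (h ∘ fun x => x + u • e)) with hΨ'
  have hΨb' : IsBddFun Ψ' := hbdd k h hkb hhb (fun _ => id) _
  -- The change of variables removes `u` from the first factor and leaves a translation by a
  -- multiple of `u` in the second one.
  have e1 : l (fun u => L ((h ∘ affineShear e (b * u)) * (h ∘ affineShear e (c * u)))) =
      l (Ψ' ∘ fun u => d • u) := by
    refine hl.congr_of_forall_ne_zero hlinv (hbdd h h hhb hhb _ _) (hΨb'.comp _) fun u hu => ?_
    rw [← hLinv (u * c) (mul_ne_zero hu hc) (-(u ^ 2 * b ^ 2)) _ ((hhb.comp _).mul (hhb.comp _))]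
    simp only [hΨ', Function.comp_apply]
    congr 1
    ext x
    have a1 : affineShear e (b * u) ((u * c) • x + (-(u ^ 2 * b ^ 2)) • e) = (b⁻¹ * c) • x := by
      rw [affineShear, smul_add, smul_smul, smul_smul, add_assoc, ← add_smul]
      have h1 : (b * u)⁻¹ * (u * c) = b⁻¹ * c := by field_simp
      have h2 : (b * u)⁻¹ * -(u ^ 2 * b ^ 2) + b * u = 0 := by field_simp; ring
      rw [h1, h2, zero_smul, add_zero]
    have a2 : affineShear e (c * u) ((u * c) • x + (-(u ^ 2 * b ^ 2)) • e) = x + (d • u) • e := by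
      rw [affineShear, smul_add, smul_smul, smul_smul, add_assoc, ← add_smul]
      have h1 : (c * u)⁻¹ * (u * c) = 1 := by field_simp
      have h2 : (c * u)⁻¹ * -(u ^ 2 * b ^ 2) + c * u = d • u := by
        rw [hd, smul_eq_mul]; field_simp; ring
      rw [h1, h2, one_smul]
    simp only [Pi.mul_apply, Function.comp_apply, a1, a2, hk, id]
  have e2 : Ψ' = Ψ - Ψ ∘ fun u => u + v • (1 : K) := by
    ext u
    simp only [hΨ', hΨ, Pi.sub_apply, Function.comp_apply, ← map_sub, ← mul_sub]
    congr 2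
    ext x
    simp only [hh, Function.comp_apply, Pi.sub_apply, add_smul, smul_assoc, one_smul, add_assoc]
  rw [e1, hlinv.dilation hd0 _ hΨb', e2, map_sub, hlinv.translation v Ψ hΨb, sub_self]

/-- The ergodic theorem for the affine group: on average over `u`, a function correlates with its
affine images at least as much as if they were independent. -/
theorem sq_le_average_correlation (hl : IsMean l) (hlinv : IsAffineInvariant K (1 : K) l)
    (hL : IsMean L) (hLinv : IsAffineInvariant K e L) {f : X → ℝ} (hf : ∀ x, |f x| ≤ 1) :
    L f ^ 2 ≤ l (fun u : K => L ((f ∘ fun x => x + u • e) * (f ∘ fun x => u • x))) := by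
  have hfb : IsBddFun f := ⟨1, hf⟩
  have mul1 : ∀ {g h : X → ℝ}, (∀ x, |g x| ≤ 1) → (∀ x, |h x| ≤ 1) → ∀ x, |(g * h) x| ≤ 1 :=
    fun hg hh x => by
      rw [Pi.mul_apply, abs_mul]
      exact mul_le_one₀ (hg x) (abs_nonneg _) (hh x)
  have hff : L (f * f) ≤ 1 ^ 2 := by
    rw [one_pow]
    exact (le_abs_self _).trans (hL.abs_le (mul1 hf hf))
  have hchange : l (fun u : K => L ((f ∘ fun x => x + u • e) * (f ∘ fun x => u • x))) =
      l (fun u => L (f * f ∘ affineShear e u)) := by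
    refine hl.congr_of_forall_ne_zero hlinv
      (hL.isBddFun_apply fun u => mul1 (fun x => hf _) (fun x => hf _))
      (hL.isBddFun_apply fun u => mul1 hf (fun x => hf _)) fun u hu => ?_
    rw [← hLinv.dilation hu (f * f ∘ affineShear e u) (hfb.mul (hfb.comp _))]
    congr 1
    ext x
    simp [affineShear, smul_smul, inv_mul_cancel₀ hu, mul_comm]
  rw [hchange]
  refine le_of_forall_pos_le_add fun δ hδ => ?_
  -- Four approximations with error `ε` follow: two inside the average and two in pairings with `g'`.
  set ε := δ / 4 with hε
  have hε0 : 0 < ε := by positivity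
  let A : K → X → X := fun v x => x + v • e
  let M : Kˣ → X → X := fun b x => (b : K) • x
  have hA : ∀ v, IsInvariantUnder L (A v) := fun v => hLinv.translation v
  have hM : ∀ b, IsInvariantUnder L (M b) := fun b => hLinv.dilation b.ne_zero
  obtain ⟨g, hg, hgA⟩ := exists_mem_orbitHull_almost_invariant hL hA
    (fun v w => ⟨w + v, by ext x; simp [A, add_smul, add_assoc]⟩) hfb
    (by positivity : 0 < ε ^ 2)
  have hg1 : ∀ x, |g x| ≤ 1 := abs_le_of_mem_orbitHull hf hg
  have hgb : IsBddFun g := ⟨1, hg1⟩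
  obtain ⟨g', hg', hgM'⟩ := exists_mem_orbitHull_almost_invariant hL hM
    (fun b c => ⟨b * c, by ext x; simp [M, mul_smul]⟩) hgb (by positivity : 0 < ε ^ 2)
  have hg1' : ∀ x, |g' x| ≤ 1 := abs_le_of_mem_orbitHull hg1 hg'
  have hgb' : IsBddFun g' := ⟨1, hg1'⟩
  -- Dilations normalize translations, so `g'` inherits almost invariance under translations.
  have hgA' : ∀ v, L ((g' ∘ A v - g') * (g' ∘ A v - g')) ≤ ε ^ 2 := by
    have hconv : Convex ℝ {q : X → ℝ | (∀ x, |q x| ≤ 1) ∧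
        ∀ v, L ((q ∘ A v - q) * (q ∘ A v - q)) ≤ ε ^ 2} := by
      rintro a ⟨ha1, ha⟩ b ⟨hb1, hb⟩ s t hs ht hst
      refine ⟨convex_setOf_abs_le X 1 ha1 hb1 hs ht hst, fun v => ?_⟩
      set a' := a ∘ A v - a with ha'
      set b' := b ∘ A v - b with hb'
      have hab' : IsBddFun a' := IsBddFun.sub (IsBddFun.comp ⟨1, ha1⟩ _) ⟨1, ha1⟩
      have hbb' : IsBddFun b' := IsBddFun.sub (IsBddFun.comp ⟨1, hb1⟩ _) ⟨1, hb1⟩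
      have e1 : (s • a + t • b) ∘ A v - (s • a + t • b) = s • a' + t • b' := by
        ext x; simp [ha', hb']; ring
      have hcb : IsBddFun (s • a' + t • b') := (hab'.smul s).add (hbb'.smul t)
      rw [e1]
      calc L ((s • a' + t • b') * (s • a' + t • b'))
          ≤ L (s • (a' * a') + t • (b' * b')) := by
            refine hL.mono (hcb.mul hcb)
              (((hab'.mul hab').smul s).add ((hbb'.mul hbb').smul t)) fun x => ?_
            have := mul_nonneg (mul_nonneg hs ht) (sq_nonneg (a' x - b' x))
            obtain rfl : t = 1 - s := by linarith
            simp only [Pi.mul_apply, Pi.add_apply, Pi.smul_apply, smul_eq_mul]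
            linarith
        _ = s * L (a' * a') + t * L (b' * b') := by
            rw [map_add, map_smul, map_smul, smul_eq_mul, smul_eq_mul]
        _ ≤ s * ε ^ 2 + t * ε ^ 2 := add_le_add (mul_le_mul_of_nonneg_left (ha v) hs)
            (mul_le_mul_of_nonneg_left (hb v) ht)
        _ = ε ^ 2 := by rw [← add_mul, hst, one_mul]
    refine (orbitHull_subset hconv (fun b => ⟨fun x => hg1 _, fun v => ?_⟩) hg').2
    have e1 : (g ∘ M b) ∘ A v - g ∘ M b = (g ∘ A (b * v) - g) ∘ M b := by
      ext x; simp [A, M, mul_smul]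
    have hb : IsBddFun (g ∘ A (b * v) - g) := (hgb.comp _).sub hgb
    rw [e1]
    exact (hM b _ (hb.mul hb)).trans_le (hgA _)
  -- Up to coboundaries, which the average kills, `f` may be replaced by `g`.
  have s1 : l (fun u => L (f * f ∘ affineShear e u)) = l (fun u => L (f * g ∘ affineShear e u)) := by
    let Φ : (X → ℝ) →ₗ[ℝ] ℝ :=
      { toFun := fun q => l (fun u => L (f * q ∘ affineShear e u))
        map_add' := fun q r => by
          rw [← map_add]
          congr 1
          ext u
          rw [Pi.add_apply, ← map_add, ← mul_add]
          rfl
        map_smul' := fun a q => by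
          rw [RingHom.id_apply, ← map_smul]
          congr 1
          ext u
          rw [Pi.smul_apply, ← map_smul, ← mul_smul_comm]
          rfl }
    refine (apply_eq_of_mem_orbitHull Φ (fun v => ?_) hg).symm
    have h0 : Φ (f - f ∘ A v) = 0 := average_coboundary hl hlinv hL hLinv hfb hfb v
    rw [map_sub, sub_eq_zero] at h0
    exact h0.symm
  have sqb : ∀ {h : X → ℝ}, IsBddFun h → L (h * h) ≤ ε ^ 2 → |L (f * h)| ≤ ε := fun hh h2 => by
    simpa using hL.abs_mul_le hfb hh zero_le_one hε0.le hff h2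
  have bd2 : ∀ {q : X → ℝ}, (∀ x, |q x| ≤ 1) → ∀ T : K → X → X,
      IsBddFun fun u => L (f * q ∘ T u) := fun hq T =>
    hL.isBddFun_apply fun u => mul1 hf (fun x => hq _)
  have s2 : |l (fun u => L (f * g ∘ affineShear e u)) -
      l (fun u : K => L (f * g ∘ fun x => u⁻¹ • x))| ≤ ε := by
    rw [← map_sub]
    refine hl.abs_le_of_forall_ne_zero hlinv ((bd2 hg1 _).sub (bd2 hg1 _)) hε0.le fun u hu => ?_
    rw [Pi.sub_apply, ← map_sub, ← mul_sub]
    have hb : IsBddFun (g ∘ A u - g) := (hgb.comp _).sub hgb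
    exact sqb ((hgb.comp _).sub (hgb.comp _))
      ((hLinv.dilation (inv_ne_zero hu) _ (hb.mul hb)).trans_le (hgA u))
  have s3 : l (fun u : K => L (f * g ∘ fun x => u⁻¹ • x)) =
      l (fun u : K => L (f * g' ∘ fun x => u⁻¹ • x)) := by
    let Φ : (X → ℝ) →ₗ[ℝ] ℝ :=
      { toFun := fun q => l (fun u : K => L (f * q ∘ fun x => u⁻¹ • x))
        map_add' := fun q r => by
          rw [← map_add]
          congr 1
          ext u
          rw [Pi.add_apply, ← map_add, ← mul_add]
          rfl
        map_smul' := fun a q => by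
          rw [RingHom.id_apply, ← map_smul]
          congr 1
          ext u
          rw [Pi.smul_apply, ← map_smul, ← mul_smul_comm]
          rfl }
    refine (apply_eq_of_mem_orbitHull Φ (fun b => ?_) hg').symm
    refine Eq.trans ?_ (hlinv.dilation (inv_ne_zero b.ne_zero) _ (bd2 hg1 _))
    refine congrArg l (funext fun u => congrArg L (congrArg (f * ·) (funext fun x => ?_)))
    simp [M, smul_smul, mul_comm]
  have s4 : |l (fun u : K => L (f * g' ∘ fun x => u⁻¹ • x)) - L (f * g')| ≤ ε := by
    rw [← hl.const (L (f * g')), ← map_sub]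
    refine hl.abs_le_of_forall_ne_zero hlinv ((bd2 hg1' _).sub (.const _)) hε0.le fun u hu => ?_
    rw [Pi.sub_apply, ← map_sub, ← mul_sub]
    exact sqb ((hgb'.comp _).sub hgb') (hgM' (Units.mk0 u hu)⁻¹)
  have s5 : |L (f * g') - L (g * g')| ≤ ε :=
    abs_sub_le_of_mem_orbitHull hL hA hf hgb' hε0 hgA' hg
  have s6 : |L (g * g') - L (g' * g')| ≤ ε :=
    abs_sub_le_of_mem_orbitHull hL hM hg1 hgb' hε0 hgM' hg'
  have s7 : L f ^ 2 ≤ L (g' * g') := by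
    have h1 : L g = L f := apply_eq_of_mem_orbitHull L (fun v => hA v f hfb) hg
    have h2 : L g' = L g := apply_eq_of_mem_orbitHull L (fun b => hM b g hgb) hg'
    rw [← h1, ← h2]
    exact hL.sq_le hgb'
  rw [s1]
  rw [s3] at s2
  rw [abs_le] at s2 s4 s5 s6
  linarith [s2.1, s4.1, s5.1, s6.1]

end Ergodic

/-! ### Densities and colorings -/

lemma isAffineInvariant_of_translation_of_dilation {K X : Type*} [Field K] [AddCommGroup X]
    [Module K X] {e : X} {L : (X → ℝ) →ₗ[ℝ] ℝ}
    (ht : ∀ s : K, s ≠ 0 → IsInvariantUnder L fun x => x + s • e)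
    (hd : ∀ a : K, a ≠ 0 → IsInvariantUnder L fun x => a • x) : IsAffineInvariant K e L := by
  intro a ha s f hf
  by_cases hs : s = 0
  · simpa [hs] using hd a ha f hf
  · rw [← ht s hs f hf]
    exact hd a ha (f ∘ fun x => x + s • e) (hf.comp _)

namespace IsDoubleFolner

variable {K : Type*} [Field K] {F : ℕ → Finset K}

lemma tendsto_add_finset [DecidableEq K] (hF : IsDoubleFolner F) {s : K} (hs : s ≠ 0) :
    Tendsto (fun N => (((F N) ∩ (F N).image fun a => a + s).card : ℝ) / ((F N).card : ℝ))
      atTop (𝓝 1) := by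
  refine (hF.tendsto_add s hs).congr fun N => ?_
  rw [← Finset.coe_image, ← Finset.coe_inter, Set.ncard_coe_finset]

lemma tendsto_mul_finset [DecidableEq K] (hF : IsDoubleFolner F) {a : K} (ha : a ≠ 0) :
    Tendsto (fun N => (((F N) ∩ (F N).image fun x => a * x).card : ℝ) / ((F N).card : ℝ))
      atTop (𝓝 1) := by
  refine (hF.tendsto_mul a ha).congr fun N => ?_
  rw [← Finset.coe_image, ← Finset.coe_inter, Set.ncard_coe_finset]

lemma isAffineInvariant (hF : IsDoubleFolner F) {p : Ultrafilter ℕ} (hp : (p : Filter ℕ) ≤ atTop)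
    {l : (K → ℝ) →ₗ[ℝ] ℝ} (hl : IsLimitOfAverages p F l) : IsAffineInvariant K (1 : K) l := by
  classical
  refine isAffineInvariant_of_translation_of_dilation (fun s hs => ?_) fun a ha => ?_
  · refine hl.isInvariantUnder hF.nonempty (add_left_injective (s • (1 : K))) ?_
    simpa using (hF.tendsto_add_finset hs).mono_left hp
  · exact hl.isInvariantUnder hF.nonempty (mul_right_injective₀ ha)
      ((hF.tendsto_mul_finset ha).mono_left hp)

lemma isAffineInvariant_piFinset {J : Type*} [Fintype J] [DecidableEq J] (hF : IsDoubleFolner F)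
    {p : Ultrafilter ℕ} (hp : (p : Filter ℕ) ≤ atTop) {L : ((J → K) → ℝ) →ₗ[ℝ] ℝ}
    (hL : IsLimitOfAverages p (fun N => Fintype.piFinset fun _ : J => F N) L) :
    IsAffineInvariant K (1 : J → K) L := by
  classical
  have hne : ∀ N, (Fintype.piFinset fun _ : J => F N).Nonempty := fun N =>
    Fintype.piFinset_nonempty.2 fun _ => hF.nonempty N
  refine isAffineInvariant_of_translation_of_dilation (fun s hs => ?_) fun a ha => ?_
  · refine hL.isInvariantUnder hne (add_left_injective (s • (1 : J → K))) ?_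
    have e : (fun x : J → K => x + s • (1 : J → K)) = fun x j => x j + s := by
      ext x j; simp
    rw [e]
    exact (tendsto_card_piFinset_inter (J := J) (hF.tendsto_add_finset hs)).mono_left hp
  · exact hL.isInvariantUnder hne (fun x y h => funext fun j =>
      mul_right_injective₀ ha (congrFun h j))
      ((tendsto_card_piFinset_inter (J := J) (hF.tendsto_mul_finset ha)).mono_left hp)

end IsDoubleFolner

lemma IsLimitOfAverages.le_upperDensity {K : Type*} {F : ℕ → Finset K} {p : Ultrafilter ℕ}
    (hp : (p : Filter ℕ) ≤ atTop) {l : (K → ℝ) →ₗ[ℝ] ℝ} (hl : IsLimitOfAverages p F l)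
    (E : Set K) : l (E.indicator 1) ≤ upperDensity F E := by
  classical
  have hcount : ∀ N, (((F N : Set K) ∩ E).ncard : ℝ) = ∑ x ∈ F N, E.indicator 1 x := by
    intro N
    have : (F N : Set K) ∩ E = ((F N).filter (· ∈ E) : Finset K) := by ext; simp
    rw [this, Set.ncard_coe_finset]
    simp [Set.indicator_apply]
  have hlim := hl _ (IsBddFun.indicator E)
  refine le_of_forall_lt_imp_le_of_dense fun c hc => ?_
  refine le_limsup_of_frequently_le (Frequently.filter_mono ?_ hp) ?_
  · refine (((tendsto_order.1 hlim).1 c hc).mono fun N hN => ?_).frequently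
    rw [hcount]
    exact hN.le
  · refine isBoundedUnder_of ⟨1, fun N => div_le_one_of_le₀ ?_ (Nat.cast_nonneg _)⟩
    rw [← Set.ncard_coe_finset]
    exact_mod_cast Set.ncard_le_ncard Set.inter_subset_left (F N).finite_toSet

theorem mainTheorem1 {K : Type*} [Field K] [Countable K] [Infinite K]
    (F : ℕ → Finset K) (hF : IsDoubleFolner F)
    {ι : Type*} [Finite ι] (C : ι → Set K) (hC : ⋃ i, C i = Set.univ) :
    ∃ i : ι, ∃ D : Set K, D ⊆ C i ∧ 0 < upperDensity F D ∧
      ∀ u ∈ D, ∃ Du : Set K, 0 < upperDensity F Du ∧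
        ∀ y ∈ Du, ({u, y + u, y * u} : Set K) ⊆ C i := by
  classical
  have := Fintype.ofFinite ι
  let p : Ultrafilter ℕ := hyperfilter ℕ
  have hp : (p : Filter ℕ) ≤ atTop := Nat.hyperfilter_le_atTop
  obtain ⟨l, hl⟩ := exists_isLimitOfAverages p F
  have hlm : IsMean l := hl.isMean hF.nonempty
  let J := {i : ι // 0 < l ((C i).indicator 1)}
  obtain ⟨L, hL⟩ := exists_isLimitOfAverages p fun N => Fintype.piFinset fun _ : J => F N
  have hLm : IsMean L := hL.isMean fun N => Fintype.piFinset_nonempty.2 fun _ => hF.nonempty N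
  -- `L` is the mean on the product of one copy of `K` for each color of positive mean, and `f` is
  -- the indicator function of the box formed by these colors.
  set f : (J → K) → ℝ := fun x => ∏ j : J, (C j).indicator 1 (x j) with hf
  have ind_nonneg : ∀ (E : Set K) (x : K), (0 : ℝ) ≤ E.indicator 1 x := fun E x =>
    Set.indicator_nonneg (fun _ _ => zero_le_one) x
  have ind_le_one : ∀ (E : Set K) (x : K), E.indicator (1 : K → ℝ) x ≤ 1 := fun E x =>
    Set.indicator_le_self' (fun _ _ => zero_le_one) x
  have hf1 : ∀ x, |f x| ≤ 1 := fun x => by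
    rw [abs_of_nonneg (Finset.prod_nonneg fun j _ => ind_nonneg _ _)]
    exact Finset.prod_le_one (fun j _ => ind_nonneg _ _) fun j _ => ind_le_one _ _
  have hLf : 0 < L f := by
    rw [hf, hl.map_prod hL (fun j => IsBddFun.indicator _) ⟨1, hf1⟩]
    exact Finset.prod_pos fun j _ => j.2
  -- The set of `y` which complete `u` to a pattern in the color `i`.
  let Y : K → ι → Set K := fun u i => {y | y + u ∈ C i ∧ y * u ∈ C i}
  have hcorr : ∀ u : K, L ((f ∘ fun x => x + u • 1) * (f ∘ fun x => u • x)) =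
      ∏ j : J, l ((Y u j).indicator 1) := by
    intro u
    have e : ((f ∘ fun x => x + u • 1) * (f ∘ fun x => u • x)) =
        fun x => ∏ j : J, (Y u j).indicator 1 (x j) := by
      ext x
      simp only [hf, Pi.mul_apply, Function.comp_apply, ← Finset.prod_mul_distrib]
      refine Finset.prod_congr rfl fun j _ => ?_
      by_cases h1 : x j + u ∈ C j <;> by_cases h2 : x j * u ∈ C j <;>
        simp [Y, h1, h2, mul_comm u]
    have hb : IsBddFun ((f ∘ fun x => x + u • 1) * (f ∘ fun x => u • x)) :=
      (IsBddFun.comp ⟨1, hf1⟩ _).mul (IsBddFun.comp ⟨1, hf1⟩ _)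
    rw [e] at hb ⊢
    exact hl.map_prod hL (fun j => IsBddFun.indicator _) hb
  have herg := sq_le_average_correlation hlm (hF.isAffineInvariant hp hl) hLm
    (hF.isAffineInvariant_piFinset hp hL) hf1
  simp only [hcorr] at herg
  -- The elements which start patterns in all colors of positive mean at once.
  set R : Set K := {u | ∀ j : J, 0 < l ((Y u j).indicator 1)} with hR
  have hl0 : ∀ E : Set K, 0 ≤ l (E.indicator 1) := fun E =>
    hlm.nonneg _ (.indicator E) (ind_nonneg E)
  have hl1 : ∀ E : Set K, l (E.indicator 1) ≤ 1 := fun E =>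
    (hlm.mono (.indicator E) (.const 1) (ind_le_one E)).trans_eq (hlm.const 1)
  have hRpos : 0 < l (R.indicator 1) := by
    refine (pow_pos hLf 2).trans_le (herg.trans (hlm.mono ?_ (.indicator R) fun u => ?_))
    · refine ⟨1, fun u => ?_⟩
      rw [abs_of_nonneg (Finset.prod_nonneg fun j _ => hl0 _)]
      exact Finset.prod_le_one (fun j _ => hl0 _) fun j _ => hl1 _
    · by_cases hu : u ∈ R
      · rw [Set.indicator_of_mem hu]
        exact Finset.prod_le_one (fun j _ => hl0 _) fun j _ => hl1 _
      · rw [Set.indicator_of_notMem hu]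
        simp only [hR, Set.mem_ofPred_eq, not_forall, not_lt] at hu
        obtain ⟨j, hj⟩ := hu
        exact (Finset.prod_eq_zero (Finset.mem_univ j) (le_antisymm hj (hl0 _))).le
  -- The colors cover `R`; a color meeting `R` in a set of positive mean has itself positive mean,
  -- so it is one of those for which the elements of `R` start patterns.
  obtain ⟨i, hi⟩ : ∃ i, 0 < l ((R ∩ C i).indicator 1) := by
    by_contra! hcon
    have hle : l (R.indicator 1) ≤ l (∑ i, (R ∩ C i).indicator 1) := by
      refine hlm.mono (.indicator R) (IsBddFun.sum _ fun i _ => .indicator _) fun u => ?_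
      rw [Finset.sum_apply]
      by_cases hu : u ∈ R
      · obtain ⟨i, hi⟩ := Set.mem_iUnion.1 (hC.symm ▸ Set.mem_univ u : u ∈ ⋃ i, C i)
        have h1 := Finset.single_le_sum (f := fun i => (R ∩ C i).indicator (1 : K → ℝ) u)
          (fun i _ => ind_nonneg _ _) (Finset.mem_univ i)
        rw [Set.indicator_of_mem hu]
        simpa [Set.indicator_of_mem (Set.mem_inter hu hi)] using h1
      · rw [Set.indicator_of_notMem hu]
        exact Finset.sum_nonneg fun i _ => ind_nonneg _ _
    rw [map_sum] at hle
    exact absurd (hRpos.trans_le hle) (not_lt.2 (Finset.sum_nonpos fun i _ => hcon i))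
  have hCi : 0 < l ((C i).indicator 1) := hi.trans_le <|
    hlm.mono (.indicator _) (.indicator _) fun u =>
      Set.indicator_le_indicator_of_subset Set.inter_subset_right (fun _ => zero_le_one) u
  refine ⟨i, R ∩ C i, Set.inter_subset_right, hi.trans_le (hl.le_upperDensity hp _),
    fun u hu => ⟨Y u i, (hu.1 ⟨i, hCi⟩).trans_le (hl.le_upperDensity hp _), fun y hy => ?_⟩⟩
  rintro z (rfl | rfl | rfl)
  exacts [hu.2, hy.1, hy.2]
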